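/- Conventions. For probability measures $p,q$ on a metric space let $\Pi(p,q)$ be the set of measures on the product with first marginal $p$ and second marginal $q$, let $W(p,q)=\inf_{\pi\in\Pi(p,q)}\mathbb E_{(x,y)\sim\pi}[d(x,y)]$, and call $\pi\in\Pi(p,q)$ an optimal coupling if it attains this infimum. For a set $D$ that carries $p_r$ and $q$, an optimal discriminator on $D$ is a function $f^*$ that is $1$-Lipschitz on $D$ and maximizes $\mathbb E_{x\sim p_r}[f(x)]-\mathbb E_{x\sim q}[f(x)]$ over all functions $f$ that are $1$-Lipschitz on $D$. For $D$ in a Hilbert space, $\nabla f(z)=g$ at $z\in D$ means $f(z')=f(z)+\langle g,z'-z\rangle+o(\|z'-z\|)$ as $z'\to z$, $z'\in D$ (the usual gradient if $D$ is the whole space). (1) Let $p_r$ and $q$ be Borel probability measures on a compact metric space $X$. Then there is an optimal discriminator $f^*$ on $X$, and there is an optimal coupling $\pi^*\in\Pi(q,p_r)$. (2) Let $E$ be a separable real Hilbert space (for instance $\mathbb R^n$ with the Euclidean norm), $X\subseteq E$ compact and $D\subseteq E$ convex with $X\subseteq D$ (for instance $D=E$, or $D=X$ if $X$ is convex), and let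 $p_r$ and $q$ be Borel probability measures on $E$ that are concentrated on $X$. Let $f^*$ be an optimal discriminator on $D$, let $\pi^*\in\Pi(q,p_r)$ be an optimal coupling, so that $x\sim q$ and $y\sim p_r$ for $(x,y)\sim\pi^*$, and write $x_\tau=\tau x+(1-\tau)y$. If $f^*$ is differentiable on $D$ and $\pi^*(x=y)=0$, then for $\pi^*$-almost every $(x,y)$ and all $\tau\in[0,1]$, $$\nabla f^*(x_\tau)=\frac{y-x}{\|y-x\|},\qquad\text{that is,}\qquad \nabla f^*(x_\tau)=\frac{y-x_\tau}{\|y-x_\tau\|}\ \text{ whenever }\tau\neq0 .$$ (3) Let $E,X,D,p_r$ be as in (2), let $p_\theta$ be a Borel probability measure on $E$ concentrated on $X$, let $f_\phi$ be continuous on $X$, and let $q$ be the exponentially tilted distribution $q(dx)=e^{f_\phi(x)}p_\theta(dx)/Z_\phi$ with $Z_\phi=\int e^{f_\phi}\,dp_\theta$. Then $q$ is a probability measure, $q$ and $p_\theta$ are mutually absolutely continuous, and they have the same support. Moreover, if $f^*$ and $\pi^*$ are as in (2) for this $q$, with $f^*$ differentiable on $D$ and $\pi^*(x=y)=0$, then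 for $p_\theta$-almost every $x$ there is a point $y\neq x$ in the support of $p_r$ such that for all $\tau\in[0,1]$ the gradient $\nabla f^*(x_\tau)$ is $(y-x)/\|y-x\|$, which for $\tau\ne0$ is $(y-x_\tau)/\|y-x_\tau\|$. -/

import Mathlib

open MeasureTheory

namespace WGan

/-- The couplings of two measures `p` and `q`: the measures on the product whose first marginal
is `p` and whose second marginal is `q`. -/
def couplings {α : Type*} [MeasurableSpace α] (p q : Measure α) : Set (Measure (α × α)) :=
  {π | π.map Prod.fst = p ∧ π.map Prod.snd = q}

/-- The transport cost `E_{(x, y) ∼ π} [d(x, y)]`, with values in `[0, ∞]`. -/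
noncomputable def transportCost {α : Type*} [MeasurableSpace α] [MetricSpace α]
    (π : Measure (α × α)) : ENNReal :=
  ∫⁻ z, edist z.1 z.2 ∂π

/-- The Wasserstein distance: the infimum of the transport cost over all couplings. -/
noncomputable def wasserstein {α : Type*} [MeasurableSpace α] [MetricSpace α]
    (p q : Measure α) : ENNReal :=
  ⨅ π ∈ couplings p q, transportCost π

/-- `π` is an optimal coupling of `p` and `q`: a coupling at which the infimum defining the
Wasserstein distance is attained. -/
def IsOptimalCoupling {α : Type*} [MeasurableSpace α] [MetricSpace α]
    (p q : Measure α) (π : Measure (α × α)) : Prop :=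
  π ∈ couplings p q ∧ transportCost π = wasserstein p q

/-- The objective of the discriminator, `E_{x ∼ p} [f x] - E_{x ∼ q} [f x]`. -/
noncomputable def criticValue {α : Type*} [MeasurableSpace α]
    (p q : Measure α) (f : α → ℝ) : ℝ :=
  (∫ x, f x ∂p) - ∫ x, f x ∂q

/-- `f` is an optimal discriminator on the domain `D`: it is `1`-Lipschitz on `D` and maximizes
`E_p [f] - E_q [f]` among all functions that are `1`-Lipschitz on `D`.
(It is only used for measures that are concentrated on a compact subset of `D`; then all the
integrals exist, and the values of the functions outside `D` play no role.) -/
def IsOptimalCritic {α : Type*} [MeasurableSpace α] [MetricSpace α]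
    (D : Set α) (p q : Measure α) (f : α → ℝ) : Prop :=
  LipschitzOnWith 1 f D ∧
    ∀ g : α → ℝ, LipschitzOnWith 1 g D → criticValue p q g ≤ criticValue p q f

section Gradient

variable {E : Type*} [NormedAddCommGroup E] [InnerProductSpace ℝ E]

/-- The interpolate `x_τ = τ x + (1 - τ) y`. -/
def interpolate (x y : E) (τ : ℝ) : E := τ • x + (1 - τ) • y

/-- The unit vector `(b - a) / ‖b - a‖` that points from `a` to `b` (used for `a ≠ b` only). -/
noncomputable def unitVector (a b : E) : E := ‖b - a‖⁻¹ • (b - a)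

/-- At every interpolate `x_τ` of `x` and `y`, `0 ≤ τ ≤ 1`, the gradient of `f` (as a function
on `D`) is the unit vector from `x` to `y`; when `τ ≠ 0`, so that `x_τ ≠ y` for `x ≠ y`, it is the
unit vector `(y - x_τ) / ‖y - x_τ‖` from `x_τ` to `y`. -/
def HasInformativeGradient [CompleteSpace E] (D : Set E) (f : E → ℝ) (x y : E) : Prop :=
  ∀ τ ∈ Set.Icc (0 : ℝ) 1,
    HasGradientWithinAt f (unitVector x y) D (interpolate x y τ) ∧
    (τ ≠ 0 →
      HasGradientWithinAt f (unitVector (interpolate x y τ) y) D (interpolate x y τ))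

end Gradient

end WGan

/-! Existence of a discriminator is Arzelà–Ascoli, since the objective ignores additive constants.
Existence of a coupling comes from Kantorovich–Rubinstein duality
(`exists_coupling_transportCost_le`): Hahn–Banach and Riesz produce a coupling whose cost is at most
the optimal critic value `K`, while no coupling costs less than `K`.

For the gradients, duality forces `f y - f x = dist x y` almost surely under an optimal coupling
(`ae_sub_eq_dist`), so `f` has slope one along the whole segment. On `D` it is squeezed between the
cones `f y - dist y w` and `f x + dist x w`, which touch it on the segment. At interior points both
cones are smooth with the same gradient. At an endpoint one cone has its apex, and the assumed
differentiability replaces it (`hasFDerivWithinAt_left`).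

The tilted case follows by projecting to the first marginal and using that `p_θ` is absolutely
continuous with respect to its tilt. -/

namespace WGan

/-! ### Optimal discriminators on a compact space -/

open BoundedContinuousFunction in
-- Pinning removes the additive constants: the values are then bounded by the diameter, and the
-- common Lipschitz constant gives equicontinuity.
lemma isCompact_lipschitz_pinned {X : Type*} [MetricSpace X] [CompactSpace X]
    (x₀ : X) :
    IsCompact {f : X →ᵇ ℝ | LipschitzWith 1 f ∧ f x₀ = 0} := by
  refine arzela_ascoli₂ (Metric.closedBall 0 (Metric.diam (Set.univ : Set X)))
    (isCompact_closedBall _ _) _ ?_ ?_ ?_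
  · refine IsClosed.inter ?_ ?_
    · exact (isClosed_setOfPred_lipschitzWith (α := X) (β := ℝ) 1).preimage
        (continuous_pi fun x => continuous_eval_const x)
    · exact isClosed_eq (continuous_eval_const x₀) continuous_const
  · intro f x hf
    have h := hf.1.dist_le_mul x x₀
    rw [hf.2] at h
    refine h.trans ?_
    simpa using Metric.dist_le_diam_of_mem isCompact_univ.isBounded (Set.mem_univ x)
      (Set.mem_univ x₀)
  · exact (LipschitzWith.uniformEquicontinuous _ 1 fun f => f.2.1).equicontinuous

section Compact

variable {X : Type*} [MetricSpace X] [CompactSpace X] [MeasurableSpace X] [BorelSpace X]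

lemma integrable_of_continuous {μ : Measure X} [IsFiniteMeasure μ] {f : X → ℝ}
    (hf : Continuous f) : Integrable f μ :=
  hf.integrable_of_hasCompactSupport (HasCompactSupport.of_compactSpace f)

open BoundedContinuousFunction in
lemma continuous_integral_boundedContinuousFunction (μ : Measure X) [IsProbabilityMeasure μ] :
    Continuous fun f : X →ᵇ ℝ => ∫ x, f x ∂μ := by
  refine (LipschitzWith.of_dist_le_mul (K := 1) fun f g => ?_).continuous
  rw [dist_eq_norm, ← integral_sub (integrable_of_continuous f.continuous)
    (integrable_of_continuous g.continuous)]
  refine (norm_integral_le_of_norm_le_const (C := dist f g)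
    (Filter.Eventually.of_forall fun x => ?_)).trans (by simp)
  rw [← dist_eq_norm]
  exact dist_coe_le_dist x

theorem exists_isOptimalCritic (p q : Measure X) [IsProbabilityMeasure p]
    [IsProbabilityMeasure q] : ∃ f : X → ℝ, IsOptimalCritic Set.univ p q f := by
  obtain ⟨x₀⟩ : Nonempty X := nonempty_of_isProbabilityMeasure p
  obtain ⟨f, hf, hmax⟩ := (isCompact_lipschitz_pinned x₀).exists_isMaxOn
    ⟨0, LipschitzWith.const' (0 : ℝ), rfl⟩
    ((continuous_integral_boundedContinuousFunction p).sub
      (continuous_integral_boundedContinuousFunction q)).continuousOn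
  refine ⟨f, hf.1.lipschitzOnWith, fun g hg => ?_⟩
  rw [lipschitzOnWith_univ] at hg
  -- Normalising the competitor at `x₀` costs nothing: both measures have mass one, so the constant
  -- cancels.
  let g' : X → ℝ := fun x => g x - g x₀
  have hg' : LipschitzWith 1 g' := LipschitzWith.of_dist_le_mul fun x y => by
    simpa [g'] using hg.dist_le_mul x y
  have h := hmax (show BoundedContinuousFunction.mkOfCompact ⟨g', hg'.continuous⟩ ∈ _ from
    ⟨hg', sub_self _⟩)
  have hi : ∀ (μ : Measure X) [IsProbabilityMeasure μ], ∫ x, g' x ∂μ = ∫ x, g x ∂μ - g x₀ := by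
    intro μ _
    rw [integral_sub (integrable_of_continuous hg.continuous) (integrable_const _)]
    simp
  have h' : (∫ x, g' x ∂p) - ∫ x, g' x ∂q ≤ (∫ x, f x ∂p) - ∫ x, f x ∂q := h
  rw [hi, hi] at h'
  unfold criticValue
  linarith

/-- If `φ x + ψ y + t d(x, y)` is bounded below by `c`, then the same holds for the expectation of
`φ` and `ψ`, with the distance replaced by the maximal value of the critic. -/
lemma le_integral_add_integral_add_mul_criticValue {p q : Measure X} [IsProbabilityMeasure p]
    [IsProbabilityMeasure q] {f : X → ℝ} (hf : IsOptimalCritic Set.univ p q f) {φ ψ : X → ℝ}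
    (hφ : Continuous φ) (hψ : Continuous ψ) {t c : ℝ} (ht : 0 ≤ t)
    (h : ∀ x y, c ≤ φ x + ψ y + t * dist x y) :
    c ≤ ∫ x, φ x ∂q + ∫ y, ψ y ∂p + t * criticValue p q f := by
  obtain ⟨x₀⟩ : Nonempty X := nonempty_of_isProbabilityMeasure p
  have key : ∃ g : X → ℝ, Continuous g ∧ (∀ y, c - ψ y ≤ g y) ∧ (∀ x, g x ≤ φ x) ∧
      criticValue p q g ≤ t * criticValue p q f := by
    -- The inf-convolution of `φ` with `t * dist` is `t`-Lipschitz and fits between `c - ψ` and `φ`.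
    let g : X → ℝ := fun y => ⨅ x, (φ x + t * dist x y)
    have hbdd : ∀ y, BddBelow (Set.range fun x => φ x + t * dist x y) := fun y =>
      ⟨c - ψ y, by rintro _ ⟨x, rfl⟩; have := h x y; dsimp only; linarith⟩
    have hne : Nonempty X := ⟨x₀⟩
    have hg1 : ∀ y z, g y ≤ g z + t * dist y z := by
      intro y z
      rw [← sub_le_iff_le_add]
      refine le_ciInf fun x => ?_
      have h1 : g y ≤ φ x + t * dist x y := ciInf_le (hbdd y) x
      have h2 := mul_le_mul_of_nonneg_left (dist_triangle x z y) ht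
      rw [dist_comm z y] at h2
      linarith
    have hg2 : LipschitzWith ⟨t, ht⟩ g := LipschitzWith.of_le_add_mul _ hg1
    refine ⟨g, hg2.continuous, fun y => le_ciInf fun x => ?_, fun x => ?_, ?_⟩
    · have := h x y
      linarith
    · simpa using ciInf_le (hbdd x) x
    -- For `t = 0` the function `g` is constant and has critic value zero; otherwise `t⁻¹ * g`
    -- competes with `f`.
    · rcases ht.eq_or_lt with rfl | ht'
      · have hc : ∀ y, g y = g x₀ := fun y =>
          le_antisymm (by simpa using hg1 y x₀) (by simpa using hg1 x₀ y)
        simp [criticValue, hc]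
      · have h1 : LipschitzOnWith 1 (fun x => t⁻¹ * g x) Set.univ := by
          rw [lipschitzOnWith_univ]
          refine LipschitzWith.of_le_add fun y z => ?_
          have := mul_le_mul_of_nonneg_left (hg1 y z) (inv_nonneg.2 ht)
          rwa [mul_add, inv_mul_cancel_left₀ ht'.ne'] at this
        have h2 := hf.2 _ h1
        simp only [criticValue, integral_const_mul] at h2 ⊢
        rw [← mul_sub, inv_mul_le_iff₀ ht'] at h2
        exact h2
  obtain ⟨g, hgc, hg1, hg2, hg3⟩ := key
  have i1 : ∫ y, (c - ψ y) ∂p ≤ ∫ y, g y ∂p :=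
    integral_mono ((integrable_const _).sub (integrable_of_continuous hψ))
      (integrable_of_continuous hgc) hg1
  have i2 : ∫ y, g y ∂q ≤ ∫ y, φ y ∂q :=
    integral_mono (integrable_of_continuous hgc) (integrable_of_continuous hφ) hg2
  rw [integral_sub (integrable_const _) (integrable_of_continuous hψ)] at i1
  simp only [integral_const, probReal_univ, smul_eq_mul, one_mul] at i1
  unfold criticValue at hg3 ⊢
  linarith

end Compact

/-! ### Duality and optimal couplings -/

section Coupling

set_option linter.unusedSectionVars false

variable {X : Type*} [MetricSpace X] [CompactSpace X] [MeasurableSpace X] [BorelSpace X]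

/-- The upper bounds for the value at `h` of a functional on `X × X` that is at most `K` at the
distance and restricts to the expectation under `q` and `p` on functions of one variable. -/
def marginalBounds (p q : Measure X) (K : ℝ) (h : X × X → ℝ) : Set ℝ :=
  {v | ∃ φ ψ : X → ℝ, ∃ t : ℝ, Continuous φ ∧ Continuous ψ ∧ 0 ≤ t ∧
    (∀ x y, h (x, y) ≤ φ x + ψ y + t * dist x y) ∧
    ∫ x, φ x ∂q + ∫ y, ψ y ∂p + t * K = v}

variable {p q : Measure X}

lemma marginalBounds_nonempty {K : ℝ} {h : X × X → ℝ} (hh : Continuous h) :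
    (marginalBounds p q K h).Nonempty := by
  obtain ⟨C, hC⟩ := (isCompact_range hh).bddAbove
  exact ⟨_, fun _ => C, fun _ => 0, 0, continuous_const, continuous_const, le_rfl,
    fun x y => by simpa using hC ⟨(x, y), rfl⟩, rfl⟩

lemma marginalBounds_bddBelow [IsProbabilityMeasure p] [IsProbabilityMeasure q] {f : X → ℝ}
    (hf : IsOptimalCritic Set.univ p q f) {h : X × X → ℝ} (hh : Continuous h) :
    BddBelow (marginalBounds p q (criticValue p q f) h) := by
  obtain ⟨c, hc⟩ := (isCompact_range hh).bddBelow
  refine ⟨c, ?_⟩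
  rintro _ ⟨φ, ψ, t, hφ, hψ, ht, hle, rfl⟩
  exact le_integral_add_integral_add_mul_criticValue hf hφ hψ ht
    fun x y => (hc ⟨(x, y), rfl⟩).trans (hle x y)

open Pointwise

lemma smul_marginalBounds_subset {K c : ℝ} (hc : 0 < c) (h : X × X → ℝ) :
    c • marginalBounds p q K h ⊆ marginalBounds p q K (c • h) := by
  rintro _ ⟨_, ⟨φ, ψ, t, hφ, hψ, ht, hle, rfl⟩, rfl⟩
  refine ⟨fun x => c * φ x, fun x => c * ψ x, c * t, hφ.const_mul c, hψ.const_mul c, by positivity,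
    fun x y => ?_, ?_⟩
  · have := mul_le_mul_of_nonneg_left (hle x y) hc.le
    simp only [Pi.smul_apply, smul_eq_mul]
    linarith
  · simp only [integral_const_mul, smul_eq_mul]
    ring

/-- The reverse inclusion is the known one for `c⁻¹`, applied to `c • h`. -/
lemma marginalBounds_smul {K c : ℝ} (hc : 0 < c) (h : X × X → ℝ) :
    marginalBounds p q K (c • h) = c • marginalBounds p q K h := by
  refine Set.Subset.antisymm ?_ (smul_marginalBounds_subset hc h)
  have := smul_marginalBounds_subset (p := p) (q := q) (K := K) (inv_pos.2 hc) (c • h)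
  rw [inv_smul_smul₀ hc.ne'] at this
  rwa [← Set.smul_set_subset_smul_set_iff₀ (inv_ne_zero hc.ne'), inv_smul_smul₀ hc.ne']

lemma marginalBounds_add_subset [IsFiniteMeasure p] [IsFiniteMeasure q] {K : ℝ}
    (h₁ h₂ : X × X → ℝ) :
    marginalBounds p q K h₁ + marginalBounds p q K h₂ ⊆ marginalBounds p q K (h₁ + h₂) := by
  rintro _ ⟨_, ⟨φ, ψ, t, hφ, hψ, ht, hle, rfl⟩, _, ⟨φ', ψ', t', hφ', hψ', ht', hle', rfl⟩, rfl⟩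
  refine ⟨fun x => φ x + φ' x, fun x => ψ x + ψ' x, t + t', hφ.add hφ', hψ.add hψ',
    add_nonneg ht ht', fun x y => ?_, ?_⟩
  · have := hle x y
    have := hle' x y
    simp only [Pi.add_apply]
    linarith
  · dsimp only
    rw [integral_add (integrable_of_continuous hφ) (integrable_of_continuous hφ'),
      integral_add (integrable_of_continuous hψ) (integrable_of_continuous hψ')]
    ring

open CompactlySupportedContinuousMap CompactlySupported

/-- A continuous function on a compact space, as a compactly supported function. -/
def toCompactlySupported {Y : Type*} [TopologicalSpace Y] [CompactSpace Y] (h : Y → ℝ)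
    (hh : Continuous h) : C_c(Y, ℝ) :=
  ⟨⟨h, hh⟩, HasCompactSupport.of_compactSpace h⟩

/-- The infimum of `marginalBounds` is a sublinear functional of `h`, finite by the inf-convolution
bound. Hahn–Banach extends the zero map on the zero subspace below it. -/
lemma exists_linearMap_le_marginalBounds [IsProbabilityMeasure p] [IsProbabilityMeasure q]
    {f : X → ℝ} (hf : IsOptimalCritic Set.univ p q f) :
    ∃ Λ : C_c(X × X, ℝ) →ₗ[ℝ] ℝ, ∀ h : C_c(X × X, ℝ),
      ∀ v ∈ marginalBounds p q (criticValue p q f) h, Λ h ≤ v := by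
  have hne : ∀ h : C_c(X × X, ℝ), (marginalBounds p q (criticValue p q f) h).Nonempty :=
    fun h => marginalBounds_nonempty (map_continuous h)
  have hbdd : ∀ h : C_c(X × X, ℝ), BddBelow (marginalBounds p q (criticValue p q f) h) :=
    fun h => marginalBounds_bddBelow hf (map_continuous h)
  have hzero : 0 ≤ sInf (marginalBounds p q (criticValue p q f) (0 : C_c(X × X, ℝ))) := by
    refine le_csInf (hne 0) ?_
    rintro _ ⟨φ, ψ, t, hφ, hψ, ht, hle, rfl⟩
    exact le_integral_add_integral_add_mul_criticValue hf hφ hψ ht hle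
  have hsmul : ∀ c : ℝ, 0 < c → ∀ h : C_c(X × X, ℝ),
      sInf (marginalBounds p q (criticValue p q f) (c • h)) =
        c * sInf (marginalBounds p q (criticValue p q f) h) := fun c hc h => by
    rw [marginalBounds_smul hc, Real.sInf_smul_of_nonneg hc.le, smul_eq_mul]
  have hadd : ∀ h₁ h₂ : C_c(X × X, ℝ),
      sInf (marginalBounds p q (criticValue p q f) (h₁ + h₂)) ≤
        sInf (marginalBounds p q (criticValue p q f) h₁) +
          sInf (marginalBounds p q (criticValue p q f) h₂) := fun h₁ h₂ => by
    rw [← csInf_add (hne h₁) (hbdd h₁) (hne h₂) (hbdd h₂)]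
    exact csInf_le_csInf (hbdd (h₁ + h₂)) ((hne h₁).add (hne h₂)) (marginalBounds_add_subset _ _)
  obtain ⟨Λ, -, hΛ⟩ := exists_extension_of_le_sublinear
    (⟨⊥, 0⟩ : C_c(X × X, ℝ) →ₗ.[ℝ] ℝ)
    (fun h => sInf (marginalBounds p q (criticValue p q f) h)) hsmul hadd (by
      intro x
      obtain rfl : x = 0 := Subsingleton.elim (α := (⊥ : Submodule ℝ C_c(X × X, ℝ))) _ _
      exact hzero)
  exact ⟨Λ, fun h v hv => (hΛ h).trans (csInf_le (hbdd h) hv)⟩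

lemma exists_measure_integral_le_marginalBounds [IsProbabilityMeasure p] [IsProbabilityMeasure q]
    {f : X → ℝ} (hf : IsOptimalCritic Set.univ p q f) :
    ∃ π : Measure (X × X), IsFiniteMeasure π ∧ ∀ h : X × X → ℝ, Continuous h →
      ∀ v ∈ marginalBounds p q (criticValue p q f) h, ∫ z, h z ∂π ≤ v := by
  obtain ⟨Λ, hΛ⟩ := exists_linearMap_le_marginalBounds hf
  -- For `h ≥ 0`, the choice `φ = ψ = 0`, `t = 0` shows that `0` is an upper bound for `-h`.
  have hpos : ∀ h : C_c(X × X, ℝ), 0 ≤ h → 0 ≤ Λ h := by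
    intro h hh
    have := hΛ (-h) 0 ⟨fun _ => 0, fun _ => 0, 0, continuous_const, continuous_const, le_rfl,
      fun x y => by simpa using hh (x, y), by simp⟩
    rw [map_neg] at this
    linarith
  refine ⟨RealRMK.rieszMeasure (PositiveLinearMap.mk₀ Λ hpos), inferInstance, fun h hh v hv => ?_⟩
  refine le_of_eq_of_le ?_ (hΛ (toCompactlySupported h hh) v hv)
  exact RealRMK.integral_rieszMeasure (PositiveLinearMap.mk₀ Λ hpos) (toCompactlySupported h hh)

lemma lintegral_edist_eq_ofReal_integral {Y : Type*} [MetricSpace Y] [MeasurableSpace Y]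
    {π : Measure (Y × Y)} (hi : Integrable (fun z => dist z.1 z.2) π) :
    transportCost π = ENNReal.ofReal (∫ z, dist z.1 z.2 ∂π) := by
  rw [ofReal_integral_eq_lintegral_ofReal hi (Filter.Eventually.of_forall fun _ => dist_nonneg)]
  simp only [transportCost, edist_dist]

/-- **Kantorovich-Rubinstein duality** on a compact metric space. -/
theorem exists_coupling_transportCost_le [IsProbabilityMeasure p] [IsProbabilityMeasure q]
    {f : X → ℝ} (hf : IsOptimalCritic Set.univ p q f) :
    ∃ π ∈ couplings q p, transportCost π ≤ ENNReal.ofReal (criticValue p q f) := by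
  obtain ⟨π, hπ, hle⟩ := exists_measure_integral_le_marginalBounds hf
  have h₁ : ∀ φ : X → ℝ, Continuous φ → ∫ z : X × X, φ z.1 ∂π ≤ ∫ x, φ x ∂q := fun φ hφ =>
    hle _ (hφ.comp continuous_fst) _ ⟨φ, fun _ => 0, 0, hφ, continuous_const, le_rfl,
      by simp, by simp⟩
  have h₂ : ∀ ψ : X → ℝ, Continuous ψ → ∫ z : X × X, ψ z.2 ∂π ≤ ∫ y, ψ y ∂p := fun ψ hψ =>
    hle _ (hψ.comp continuous_snd) _ ⟨fun _ => 0, ψ, 0, continuous_const, hψ, le_rfl,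
      by simp, by simp⟩
  -- Testing a function and its negative turns each marginal inequality into an equality; the cost
  -- bound is the test of `dist` with `φ = ψ = 0`, `t = 1`.
  refine ⟨π, ⟨?_, ?_⟩, ?_⟩
  · refine ext_of_forall_integral_eq_of_IsFiniteMeasure fun φ => ?_
    rw [integral_map measurable_fst.aemeasurable φ.continuous.aestronglyMeasurable]
    have := h₁ (fun x => -φ x) φ.continuous.neg
    simp only [integral_neg] at this
    exact le_antisymm (h₁ φ φ.continuous) (by linarith)
  · refine ext_of_forall_integral_eq_of_IsFiniteMeasure fun ψ => ?_
    rw [integral_map measurable_snd.aemeasurable ψ.continuous.aestronglyMeasurable]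
    have := h₂ (fun x => -ψ x) ψ.continuous.neg
    simp only [integral_neg] at this
    exact le_antisymm (h₂ ψ ψ.continuous) (by linarith)
  · rw [lintegral_edist_eq_ofReal_integral (integrable_of_continuous continuous_dist)]
    refine ENNReal.ofReal_le_ofReal (hle _ continuous_dist _ ⟨fun _ => 0, fun _ => 0, 1,
      continuous_const, continuous_const, zero_le_one, by simp, by simp⟩)

lemma isProbabilityMeasure_of_mem_couplings {α : Type*} [MeasurableSpace α] {p q : Measure α}
    [IsProbabilityMeasure p] {π : Measure (α × α)} (hπ : π ∈ couplings p q) :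
    IsProbabilityMeasure π := by
  have : IsProbabilityMeasure (π.map Prod.fst) := hπ.1 ▸ inferInstance
  exact Measure.isProbabilityMeasure_of_map Prod.fst

lemma ofReal_criticValue_le_transportCost [IsProbabilityMeasure p] [IsProbabilityMeasure q]
    {f : X → ℝ} (hf : LipschitzWith 1 f) {π : Measure (X × X)} (hπ : π ∈ couplings q p) :
    ENNReal.ofReal (criticValue p q f) ≤ transportCost π := by
  have := isProbabilityMeasure_of_mem_couplings hπ
  have hc := hf.continuous
  rw [lintegral_edist_eq_ofReal_integral (integrable_of_continuous continuous_dist)]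
  refine ENNReal.ofReal_le_ofReal ?_
  have h₁ : Integrable (fun z : X × X => f z.1) π :=
    integrable_of_continuous (hc.comp continuous_fst)
  have h₂ : Integrable (fun z : X × X => f z.2) π :=
    integrable_of_continuous (hc.comp continuous_snd)
  rw [criticValue, ← hπ.1, ← hπ.2,
    integral_map measurable_fst.aemeasurable hc.aestronglyMeasurable,
    integral_map measurable_snd.aemeasurable hc.aestronglyMeasurable, ← integral_sub h₂ h₁]
  refine integral_mono (h₂.sub h₁) (integrable_of_continuous continuous_dist) fun z => ?_
  have := hf.le_add_mul z.2 z.1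
  rw [dist_comm] at this
  simp only [NNReal.coe_one, one_mul] at this
  dsimp only
  linarith

theorem exists_isOptimalCoupling (p q : Measure X) [IsProbabilityMeasure p]
    [IsProbabilityMeasure q] : ∃ π : Measure (X × X), IsOptimalCoupling p q π := by
  obtain ⟨f, hf⟩ := exists_isOptimalCritic q p
  obtain ⟨π, hπ, hle⟩ := exists_coupling_transportCost_le hf
  refine ⟨π, hπ, le_antisymm (le_iInf₂ fun π' hπ' => hle.trans ?_) (iInf₂_le π hπ)⟩
  exact ofReal_criticValue_le_transportCost (lipschitzOnWith_univ.1 hf.1) hπ'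

end Coupling

/-! ### From a compact space to a compact subset of a larger domain -/

section Transfer

set_option linter.unusedSectionVars false

variable {E : Type*} [MetricSpace E] [MeasurableSpace E] [BorelSpace E] {X : Set E}

lemma map_val_comap_val (hX : IsCompact X) {p : Measure E} (hp : p Xᶜ = 0) :
    (p.comap ((↑) : X → E)).map (↑) = p := by
  rw [map_comap_subtype_coe hX.measurableSet, Measure.restrict_eq_self_of_ae_mem]
  exact hp

lemma isProbabilityMeasure_comap_val (hX : IsCompact X) {p : Measure E} [IsProbabilityMeasure p]
    (hp : p Xᶜ = 0) : IsProbabilityMeasure (p.comap ((↑) : X → E)) := by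
  have : IsProbabilityMeasure ((p.comap ((↑) : X → E)).map ((↑) : X → E)) := by
    rw [map_val_comap_val hX hp]; infer_instance
  exact Measure.isProbabilityMeasure_of_map ((↑) : X → E)

lemma criticValue_comap_val (hX : IsCompact X) {p q : Measure E} (hp : p Xᶜ = 0) (hq : q Xᶜ = 0)
    (f : E → ℝ) :
    criticValue (p.comap ((↑) : X → E)) (q.comap (↑)) (fun x => f x) = criticValue p q f := by
  have h : ∀ {μ : Measure E}, μ Xᶜ = 0 → ∫ x : X, f x ∂(μ.comap (↑)) = ∫ x, f x ∂μ := by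
    intro μ hμ
    rw [integral_subtype_comap hX.measurableSet, Measure.restrict_eq_self_of_ae_mem]
    exact hμ
  rw [criticValue, criticValue, h hp, h hq]

lemma criticValue_congr {p q : Measure E} (hp : p Xᶜ = 0) (hq : q Xᶜ = 0) {f g : E → ℝ}
    (h : Set.EqOn f g X) : criticValue p q f = criticValue p q g := by
  have hp' : ∀ᵐ x ∂p, x ∈ X := hp
  have hq' : ∀ᵐ x ∂q, x ∈ X := hq
  rw [criticValue, criticValue, integral_congr_ae (hp'.mono h), integral_congr_ae (hq'.mono h)]

/-- Every competitor on `X` extends to a `1`-Lipschitz function on all of `E`, hence on `D`, so the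
larger domain does not lower the supremum. -/
lemma IsOptimalCritic.comap_val (hX : IsCompact X) {D : Set E} (hXD : X ⊆ D) {p q : Measure E}
    (hp : p Xᶜ = 0) (hq : q Xᶜ = 0) {f : E → ℝ} (hf : IsOptimalCritic D p q f) :
    IsOptimalCritic Set.univ (p.comap ((↑) : X → E)) (q.comap (↑)) (fun x => f x) := by
  refine ⟨fun x _ y _ => hf.1 (hXD x.2) (hXD y.2), fun g hg => ?_⟩
  have hg' : LipschitzOnWith 1 (Function.extend Subtype.val g 0) X := by
    intro x hx y hy
    have h := hg (Set.mem_univ ⟨x, hx⟩) (Set.mem_univ ⟨y, hy⟩)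
    have he : ∀ z : X, Function.extend Subtype.val g 0 z = g z :=
      fun z => Subtype.val_injective.extend_apply g 0 z
    rw [← he, ← he] at h
    exact h
  obtain ⟨G, hG, hGX⟩ := hg'.extend_real
  have hGg : (fun x : X => G x) = g := by
    ext x
    rw [← hGX x.2, Subtype.val_injective.extend_apply]
  rw [← hGg, criticValue_comap_val hX hp hq, criticValue_comap_val hX hp hq]
  exact hf.2 G hG.lipschitzOnWith

variable [SecondCountableTopology E]

lemma wasserstein_le_ofReal_criticValue (hX : IsCompact X) {D : Set E} (hXD : X ⊆ D)
    {p q : Measure E} [IsProbabilityMeasure p] [IsProbabilityMeasure q] (hp : p Xᶜ = 0)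
    (hq : q Xᶜ = 0) {f : E → ℝ} (hf : IsOptimalCritic D p q f) :
    wasserstein q p ≤ ENNReal.ofReal (criticValue p q f) := by
  have := isCompact_iff_compactSpace.1 hX
  have := isProbabilityMeasure_comap_val hX hp
  have := isProbabilityMeasure_comap_val hX hq
  obtain ⟨π, hπ, hle⟩ := exists_coupling_transportCost_le (hf.comap_val hX hXD hp hq)
  rw [criticValue_comap_val hX hp hq] at hle
  have hm : Measurable (Prod.map ((↑) : X → E) ((↑) : X → E)) :=
    measurable_subtype_coe.prodMap measurable_subtype_coe
  have hcost : transportCost (π.map (Prod.map ((↑) : X → E) ((↑) : X → E))) = transportCost π :=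
    lintegral_map (measurable_fst.edist measurable_snd) hm
  refine (iInf₂_le (π.map (Prod.map (↑) (↑))) ⟨?_, ?_⟩).trans (hcost.trans_le hle)
  · rw [Measure.map_map measurable_fst hm, Prod.map_fst',
      ← Measure.map_map measurable_subtype_coe measurable_fst, hπ.1, map_val_comap_val hX hq]
  · rw [Measure.map_map measurable_snd hm, Prod.map_snd',
      ← Measure.map_map measurable_subtype_coe measurable_snd, hπ.2, map_val_comap_val hX hp]

lemma ae_mem_of_mem_couplings {p q : Measure E} {π : Measure (E × E)} (hπ : π ∈ couplings q p)
    {A B : Set E} (hA : ∀ᵐ x ∂q, x ∈ A) (hB : ∀ᵐ y ∂p, y ∈ B) :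
    ∀ᵐ z ∂π, z.1 ∈ A ∧ z.2 ∈ B := by
  rw [← hπ.1] at hA
  rw [← hπ.2] at hB
  exact (ae_of_ae_map measurable_fst.aemeasurable hA).and
    (ae_of_ae_map measurable_snd.aemeasurable hB)

/-- An optimal critic attains the distance along an optimal coupling. -/
theorem ae_sub_eq_dist (hX : IsCompact X) {D : Set E} (hXD : X ⊆ D)
    {p q : Measure E} [IsProbabilityMeasure p] [IsProbabilityMeasure q] (hp : p Xᶜ = 0)
    (hq : q Xᶜ = 0) {f : E → ℝ} (hf : IsOptimalCritic D p q f) {π : Measure (E × E)}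
    (hπ : IsOptimalCoupling q p π) :
    ∀ᵐ z ∂π, z.1 ∈ X ∧ z.2 ∈ X ∧ f z.2 - f z.1 = dist z.1 z.2 := by
  have hW := wasserstein_le_ofReal_criticValue hX hXD hp hq hf
  rw [← hπ.2] at hW
  have hmem : ∀ᵐ z ∂π, z.1 ∈ X ∧ z.2 ∈ X := ae_mem_of_mem_couplings hπ.1 hq hp
  have hprob := isProbabilityMeasure_of_mem_couplings hπ.1
  -- Nothing is known about `f` off `D`, not even measurability; a global Lipschitz function equal
  -- to it on `X` is used for the integrals.
  obtain ⟨F, hF, hfF⟩ := (hf.1.mono hXD).extend_real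
  rw [criticValue_congr hp hq hfF] at hW
  have hid : Integrable (fun z : E × E => dist z.1 z.2) π := by
    refine Integrable.of_bound (by fun_prop) (Metric.diam X) (hmem.mono fun z hz => ?_)
    rw [Real.norm_of_nonneg dist_nonneg]
    exact Metric.dist_le_diam_of_mem hX.isBounded hz.1 hz.2
  obtain ⟨C, hC⟩ := hX.exists_bound_of_continuousOn hF.continuous.continuousOn
  have hi₁ : Integrable (fun z : E × E => F z.1) π :=
    Integrable.of_bound (hF.continuous.comp continuous_fst).aestronglyMeasurable C
      (hmem.mono fun z hz => hC _ hz.1)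
  have hi₂ : Integrable (fun z : E × E => F z.2) π :=
    Integrable.of_bound (hF.continuous.comp continuous_snd).aestronglyMeasurable C
      (hmem.mono fun z hz => hC _ hz.2)
  have hle : ∀ z : E × E, 0 ≤ dist z.1 z.2 - (F z.2 - F z.1) := fun z => by
    have := hF.le_add_mul z.2 z.1
    rw [dist_comm] at this
    simp only [NNReal.coe_one, one_mul] at this
    linarith
  have hval : criticValue p q F = ∫ z, (F z.2 - F z.1) ∂π := by
    rw [criticValue, ← hπ.1.1, ← hπ.1.2,
      integral_map measurable_fst.aemeasurable hF.continuous.aestronglyMeasurable,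
      integral_map measurable_snd.aemeasurable hF.continuous.aestronglyMeasurable,
      ← integral_sub hi₂ hi₁]
  have hnonneg : 0 ≤ ∫ z : E × E, (dist z.1 z.2 - (F z.2 - F z.1)) ∂π := integral_nonneg hle
  have hzero : ∫ z : E × E, (dist z.1 z.2 - (F z.2 - F z.1)) ∂π = 0 := by
    refine le_antisymm ?_ hnonneg
    have hd : 0 ≤ ∫ z : E × E, dist z.1 z.2 ∂π := integral_nonneg fun _ => dist_nonneg
    have hint := integral_sub hid (hi₂.sub hi₁)
    simp only [Pi.sub_apply] at hint
    rw [lintegral_edist_eq_ofReal_integral hid, hval] at hW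
    -- `ENNReal.ofReal` truncates at zero, so `hW` compares the real numbers only when the cost is
    -- positive. At zero cost almost every pair is diagonal.
    rcases hd.eq_or_lt with hd' | hd'
    · have hz := (integral_eq_zero_iff_of_nonneg (fun _ => dist_nonneg) hid).1 hd'.symm
      have : ∫ z : E × E, (dist z.1 z.2 - (F z.2 - F z.1)) ∂π = 0 := by
        refine integral_eq_zero_of_ae (hz.mono fun z hz => ?_)
        have : z.1 = z.2 := dist_eq_zero.1 hz
        simp [this]
      exact this.le
    · have := (ENNReal.ofReal_le_ofReal_iff' ).1 hW
      rw [hint]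
      rcases this with h | h <;> linarith
  have hae := (integral_eq_zero_iff_of_nonneg hle (hid.sub (hi₂.sub hi₁))).1 hzero
  filter_upwards [hmem, hae] with z hz hz'
  refine ⟨hz.1, hz.2, ?_⟩
  rw [hfF hz.1, hfF hz.2]
  exact (sub_eq_zero.1 hz').symm

end Transfer

/-! ### Gradients along segments of maximal slope -/

section Gradient

variable {E : Type*} [NormedAddCommGroup E] [InnerProductSpace ℝ E]

lemma unitVector_swap (a b : E) : unitVector b a = -unitVector a b := by
  rw [unitVector, unitVector, norm_sub_rev, ← smul_neg, neg_sub]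

lemma unitVector_eq_of_sub_eq_smul {a b a' b' : E} {c : ℝ} (hc : 0 < c)
    (h : b' - a' = c • (b - a)) : unitVector a' b' = unitVector a b := by
  rw [unitVector, unitVector, h, norm_smul, Real.norm_of_nonneg hc.le, smul_smul, mul_inv,
    mul_comm c⁻¹, mul_assoc, inv_mul_cancel₀ hc.ne', mul_one]

lemma sub_interpolate (x y : E) (τ : ℝ) : y - interpolate x y τ = τ • (y - x) := by
  rw [interpolate, sub_smul, one_smul, smul_sub]; abel

lemma interpolate_sub (x y : E) (τ : ℝ) : interpolate x y τ - x = (1 - τ) • (y - x) := by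
  rw [interpolate, smul_sub, sub_smul, sub_smul, one_smul, one_smul]; abel

lemma inner_unitVector_sub {a b : E} (h : a ≠ b) : inner ℝ (unitVector a b) (b - a) = dist a b := by
  have h' : ‖b - a‖ ≠ 0 := norm_ne_zero_iff.2 (sub_ne_zero.2 h.symm)
  rw [unitVector, real_inner_smul_left, real_inner_self_eq_norm_mul_norm, dist_comm, dist_eq_norm]
  field_simp

/-- A function that lies between two functions with the same derivative and touches both. -/
lemma hasFDerivWithinAt_of_le_of_le {D : Set E} {z : E} {a b f : E → ℝ} {L : E →L[ℝ] ℝ}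
    (ha : HasFDerivWithinAt a L D z) (hb : HasFDerivWithinAt b L D z)
    (haf : ∀ w ∈ D, a w ≤ f w) (hfb : ∀ w ∈ D, f w ≤ b w) (haz : a z = f z) (hbz : b z = f z) :
    HasFDerivWithinAt f L D z := by
  rw [hasFDerivWithinAt_iff_isLittleO] at ha hb ⊢
  refine Asymptotics.IsLittleO.of_bound fun c hc => ?_
  filter_upwards [ha.bound hc, hb.bound hc, self_mem_nhdsWithin] with w hwa hwb hw
  have h₁ := haf w hw
  have h₂ := hfb w hw
  rw [Real.norm_eq_abs, abs_le] at hwa hwb ⊢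
  constructor <;> linarith [hwa.1, hwb.2]

/-- One-sided directional derivatives of a function on a convex set. -/
lemma apply_sub_le_of_forall_le {D : Set E} (hD : Convex ℝ D) {x z : E} (hx : x ∈ D) (hz : z ∈ D)
    {f : E → ℝ} {L : E →L[ℝ] ℝ} (hf : HasFDerivWithinAt f L D x) {c : ℝ}
    (h : ∀ t ∈ Set.Ioc (0 : ℝ) 1, f (x + t • (z - x)) ≤ f x + t * c) : L (z - x) ≤ c := by
  let γ : ℝ → E := fun t => x + t • (z - x)
  have hγ : HasDerivWithinAt γ (z - x) (Set.Icc 0 1) 0 := by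
    simpa only [one_smul, id, γ] using
      (((hasDerivAt_id (0 : ℝ)).smul_const (z - x)).const_add x).hasDerivWithinAt
  have hγ0 : γ 0 = x := by simp [γ]
  have hmaps : Set.MapsTo γ (Set.Icc 0 1) D := fun t ht => hD.add_smul_sub_mem hx hz ht
  rw [← hγ0] at hf
  have hd := hf.comp_hasDerivWithinAt 0 hγ hmaps
  rw [hasDerivWithinAt_iff_tendsto_slope, Set.Icc_sdiff_left,
    nhdsWithin_Ioc_eq_nhdsGT zero_lt_one] at hd
  refine le_of_tendsto hd ?_
  filter_upwards [Ioc_mem_nhdsGT (zero_lt_one' ℝ)] with t ht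
  have h' := h t ht
  rw [slope_def_field, sub_zero, div_le_iff₀ ht.1, Function.comp_apply, Function.comp_apply, hγ0]
  change f (x + t • (z - x)) - f x ≤ _
  linarith

lemma hasFDerivAt_dist {x z : E} (h : x ≠ z) :
    HasFDerivAt (fun w => dist x w) (innerSL ℝ (unitVector x z)) z := by
  have hne : ‖z - x‖ ≠ 0 := norm_ne_zero_iff.2 (sub_ne_zero.2 h.symm)
  have h₁ := (((hasFDerivAt_id z).sub_const x).norm_sq).sqrt (pow_ne_zero 2 hne)
  simp only [id, Real.sqrt_sq (norm_nonneg _)] at h₁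
  have h₂ : (fun w => dist x w) = fun w => ‖w - x‖ := by
    ext w
    rw [dist_comm, dist_eq_norm]
  rw [h₂]
  refine h₁.congr_fderiv ?_
  ext v
  simp [unitVector]
  field_simp

lemma lipschitzOnWith_sub_le {E : Type*} [PseudoMetricSpace E] {D : Set E} {f : E → ℝ} (hf : LipschitzOnWith 1 f D) {x y : E}
    (hx : x ∈ D) (hy : y ∈ D) : f y - f x ≤ dist x y := by
  have h := hf.dist_le_mul x hx y hy
  rw [Real.dist_eq, NNReal.coe_one, one_mul, abs_le] at h
  linarith [h.1]

/-- The values of a `1`-Lipschitz function along a segment of maximal slope. -/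
lemma apply_add_smul_of_sub_eq_dist {D : Set E} (hD : Convex ℝ D) {f : E → ℝ}
    (hf : LipschitzOnWith 1 f D) {x y : E} (hx : x ∈ D) (hy : y ∈ D)
    (hxy : f y - f x = dist x y) {t : ℝ} (ht : t ∈ Set.Icc (0 : ℝ) 1) :
    f (x + t • (y - x)) = f x + t * dist x y := by
  have hz := hD.add_smul_sub_mem hx hy ht
  have h₁ := lipschitzOnWith_sub_le hf hx hz
  have h₂ := lipschitzOnWith_sub_le hf hz hy
  have e₁ : dist x (x + t • (y - x)) = t * dist x y := by
    rw [dist_self_add_right, norm_smul, Real.norm_of_nonneg ht.1, dist_comm x y, dist_eq_norm]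
  have e₂ : dist (x + t • (y - x)) y = (1 - t) * dist x y := by
    have : y - (x + t • (y - x)) = (1 - t) • (y - x) := by
      rw [sub_smul, one_smul]; abel
    rw [dist_comm, dist_eq_norm, this, norm_smul, Real.norm_of_nonneg (sub_nonneg.2 ht.2),
      dist_comm, dist_eq_norm]
  rw [e₁] at h₁
  rw [e₂] at h₂
  linarith

/-- A derivative `L` within `D` need not be unique, as `D` may have empty interior. Hence `L` is not
identified with the unit vector; the two are only compared on directions into `D`, which suffices
for a squeeze. -/
lemma hasFDerivWithinAt_left {D : Set E} (hD : Convex ℝ D) {f : E → ℝ}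
    (hf : LipschitzOnWith 1 f D) {x y : E} (hx : x ∈ D) (hy : y ∈ D)
    (hxy : f y - f x = dist x y) (hne : x ≠ y) (hdiff : DifferentiableWithinAt ℝ f D x) :
    HasFDerivWithinAt f (innerSL ℝ (unitVector x y)) D x := by
  obtain ⟨L, hL⟩ := hdiff
  have hle : ∀ z ∈ D, L (z - x) ≤ dist x z := by
    intro z hz
    refine apply_sub_le_of_forall_le hD hx hz hL fun t ht => ?_
    have := lipschitzOnWith_sub_le hf hx (hD.add_smul_sub_mem hx hz ⟨ht.1.le, ht.2⟩)
    rw [dist_self_add_right, norm_smul, Real.norm_of_nonneg ht.1.le] at this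
    rw [dist_comm x z, dist_eq_norm]
    linarith
  have heq : L (y - x) = dist x y := by
    refine le_antisymm (hle y hy) ?_
    have := apply_sub_le_of_forall_le hD hx hy hL.neg (c := -dist x y) fun t ht => by
      rw [Pi.neg_apply, Pi.neg_apply,
        apply_add_smul_of_sub_eq_dist hD hf hx hy hxy ⟨ht.1.le, ht.2⟩]
      linarith
    rw [neg_apply] at this
    linarith
  have hLu : ∀ z ∈ D, L (z - x) ≤ innerSL ℝ (unitVector x y) (z - x) := by
    intro z hz
    -- On `D` the function `L (w - x) - dist x w` is at most zero, with equality at `y`. Its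
    -- derivative at `y` is therefore nonpositive in directions into `D`, and `L - innerSL ℝ
    -- (unitVector x y)` vanishes on `y - x`.
    have hk : HasFDerivWithinAt (fun w => L (w - x) - dist x w)
        (L - innerSL ℝ (unitVector x y)) D y := by
      have h₁ : HasFDerivAt (fun w => L (w - x)) L y :=
        L.hasFDerivAt.comp y ((hasFDerivAt_id y).sub_const x)
      exact (h₁.sub (hasFDerivAt_dist hne)).hasFDerivWithinAt
    have h := apply_sub_le_of_forall_le hD hy hz hk (c := 0) fun t ht => by
      have := hle _ (hD.add_smul_sub_mem hy hz ⟨ht.1.le, ht.2⟩)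
      linarith
    have e : z - y = (z - x) - (y - x) := by abel
    rw [sub_apply, e, map_sub, heq, innerSL_apply_apply,
      inner_sub_right, inner_unitVector_sub hne] at h
    rw [innerSL_apply_apply]
    linarith
  -- The cone at `x` is not smooth there; the upper function is instead `f` with its linear part `L`
  -- exchanged for the desired one.
  refine hasFDerivWithinAt_of_le_of_le (a := fun w => f y - dist y w)
    (b := fun w => f w - L (w - x) + innerSL ℝ (unitVector x y) (w - x)) ?_ ?_ ?_ ?_ ?_ ?_
  · have h := ((hasFDerivAt_dist hne.symm).const_sub (f y)).hasFDerivWithinAt (s := D)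
    rwa [unitVector_swap, map_neg, neg_neg] at h
  · have h₁ : ∀ M : E →L[ℝ] ℝ, HasFDerivWithinAt (fun w => M (w - x)) M D x := fun M =>
      (M.hasFDerivAt.comp x ((hasFDerivAt_id x).sub_const x)).hasFDerivWithinAt
    have h := (hL.sub (h₁ L)).add (h₁ (innerSL ℝ (unitVector x y)))
    rwa [sub_self, zero_add] at h
  · intro w hw
    have := lipschitzOnWith_sub_le hf hw hy
    rw [dist_comm] at this
    linarith
  · intro w hw
    have := hLu w hw
    linarith
  · rw [dist_comm]
    linarith
  · simp

/-- Negating `f` and swapping the endpoints reduces this to the left endpoint. -/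
lemma hasFDerivWithinAt_right {D : Set E} (hD : Convex ℝ D) {f : E → ℝ}
    (hf : LipschitzOnWith 1 f D) {x y : E} (hx : x ∈ D) (hy : y ∈ D)
    (hxy : f y - f x = dist x y) (hne : x ≠ y) (hdiff : DifferentiableWithinAt ℝ f D y) :
    HasFDerivWithinAt f (innerSL ℝ (unitVector x y)) D y := by
  have hf' : LipschitzOnWith 1 (-f) D := fun a ha b hb => by
    simpa [edist_neg_neg] using hf ha hb
  have h := (hasFDerivWithinAt_left hD hf' hy hx
    (by rw [dist_comm, Pi.neg_apply, Pi.neg_apply]; linarith) hne.symm hdiff.neg).neg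
  rwa [neg_neg, unitVector_swap, map_neg, neg_neg] at h

/-- Differentiability of `f` is automatic here: neither cone has its apex at `z`. -/
lemma hasFDerivWithinAt_interior {D : Set E} {f : E → ℝ} (hf : LipschitzOnWith 1 f D) {x y z : E}
    (hx : x ∈ D) (hy : y ∈ D) (hxz : x ≠ z) (hzy : z ≠ y) (hfxz : f z - f x = dist x z)
    (hfzy : f y - f z = dist z y) (hu : unitVector x z = unitVector z y) :
    HasFDerivWithinAt f (innerSL ℝ (unitVector x z)) D z := by
  refine hasFDerivWithinAt_of_le_of_le (a := fun w => f y - dist y w)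
    (b := fun w => f x + dist x w) ?_ ?_ ?_ ?_ ?_ ?_
  · have h := ((hasFDerivAt_dist hzy.symm).const_sub (f y)).hasFDerivWithinAt (s := D)
    rwa [unitVector_swap, map_neg, neg_neg, ← hu] at h
  · exact ((hasFDerivAt_dist hxz).const_add (f x)).hasFDerivWithinAt
  · intro w hw
    have := lipschitzOnWith_sub_le hf hw hy
    rw [dist_comm] at this
    linarith
  · intro w hw
    have := lipschitzOnWith_sub_le hf hx hw
    linarith
  · rw [dist_comm]
    linarith
  · linarith

/-- The gradient of a differentiable `1`-Lipschitz function along a segment of maximal slope. -/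
theorem hasInformativeGradient_of_sub_eq_dist [CompleteSpace E] {D : Set E} (hD : Convex ℝ D)
    {f : E → ℝ} (hf : LipschitzOnWith 1 f D) (hdiff : DifferentiableOn ℝ f D) {x y : E}
    (hx : x ∈ D) (hy : y ∈ D) (hxy : f y - f x = dist x y) (hne : x ≠ y) :
    HasInformativeGradient D f x y := by
  intro τ hτ
  have hgrad : HasGradientWithinAt f (unitVector x y) D (interpolate x y τ) := by
    rw [hasGradientWithinAt_iff_hasFDerivWithinAt]
    change HasFDerivWithinAt f (innerSL ℝ (unitVector x y)) D _
    rcases hτ.1.eq_or_lt with rfl | h0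
    · have h : interpolate x y 0 = y := by simp [interpolate]
      rw [h]
      exact hasFDerivWithinAt_right hD hf hx hy hxy hne (hdiff y hy)
    rcases hτ.2.eq_or_lt with rfl | h1
    · have h : interpolate x y 1 = x := by simp [interpolate]
      rw [h]
      exact hasFDerivWithinAt_left hD hf hx hy hxy hne (hdiff x hx)
    have hyx := sub_ne_zero.2 hne.symm
    have e₁ := interpolate_sub x y τ
    have e₂ := sub_interpolate x y τ
    have h1' : 0 < 1 - τ := sub_pos.2 h1
    have hu₁ := unitVector_eq_of_sub_eq_smul h1' e₁
    have hu₂ := unitVector_eq_of_sub_eq_smul h0 e₂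
    have hv : f (interpolate x y τ) = f x + (1 - τ) * dist x y := by
      rw [← apply_add_smul_of_sub_eq_dist hD hf hx hy hxy ⟨h1'.le, by linarith⟩, ← e₁,
        add_sub_cancel]
    have d₁ : dist x (interpolate x y τ) = (1 - τ) * dist x y := by
      rw [dist_comm, dist_eq_norm, e₁, norm_smul, Real.norm_of_nonneg h1'.le, dist_comm,
        dist_eq_norm]
    have d₂ : dist (interpolate x y τ) y = τ * dist x y := by
      rw [dist_comm, dist_eq_norm, e₂, norm_smul, Real.norm_of_nonneg h0.le, dist_comm,
        dist_eq_norm]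
    rw [← hu₁]
    refine hasFDerivWithinAt_interior hf hx hy ?_ ?_ ?_ ?_ (hu₁.trans hu₂.symm)
    · rw [ne_comm, ← sub_ne_zero, e₁]
      exact smul_ne_zero h1'.ne' hyx
    · rw [ne_comm, ← sub_ne_zero, e₂]
      exact smul_ne_zero h0.ne' hyx
    · rw [d₁]; linarith
    · rw [d₂]; linarith
  refine ⟨hgrad, fun h0 => ?_⟩
  rwa [unitVector_eq_of_sub_eq_smul (lt_of_le_of_ne hτ.1 h0.symm) (sub_interpolate x y τ)]

end Gradient

/-! ### Projection to the first marginal, and integrability for the tilt -/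

section Projection

/-- If almost every pair has a property, then almost every first coordinate can be completed to a
pair that has it. Inner regularity makes up for the projection not being measurable. -/
lemma ae_exists_of_ae {E F : Type*} [TopologicalSpace E] [T2Space E] [MeasurableSpace E]
    [OpensMeasurableSpace E] [TopologicalSpace F] [MeasurableSpace F] {π : Measure (E × F)}
    [IsFiniteMeasure π] [π.InnerRegularCompactLTTop] {P : E → F → Prop}
    (h : ∀ᵐ z ∂π, P z.1 z.2) : ∀ᵐ x ∂π.map Prod.fst, ∃ y, P x y := by
  obtain ⟨N, hN, hNm, hN0⟩ := exists_measurable_superset_of_null (ae_iff.1 h)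
  have hA : π Nᶜ = π Set.univ := by rw [measure_compl hNm (measure_ne_top π N), hN0, tsub_zero]
  refine le_antisymm (ENNReal.le_of_forall_pos_le_add fun ε hε _ => ?_) bot_le
  obtain ⟨K, hKN, hK, hKε⟩ := hNm.compl.exists_isCompact_lt_add (measure_ne_top π Nᶜ)
    (ε := ε) (by exact_mod_cast hε.ne')
  -- The projection of `K` is compact, hence measurable, and each of its points has a partner since
  -- `K` avoids `N`.
  have hKm : MeasurableSet (Prod.fst '' K) := (hK.image continuous_fst).measurableSet
  calc π.map Prod.fst {x | ∃ y, P x y}ᶜ ≤ π.map Prod.fst (Prod.fst '' K)ᶜ := by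
        refine measure_mono (Set.compl_subset_compl.2 ?_)
        rintro _ ⟨z, hz, rfl⟩
        exact ⟨z.2, not_not.1 fun hP => hKN hz (hN hP)⟩
    _ = π Set.univ - π (Prod.fst ⁻¹' (Prod.fst '' K)) := by
        rw [Measure.map_apply measurable_fst hKm.compl, Set.preimage_compl,
          measure_compl (measurable_fst hKm) (measure_ne_top π _)]
    _ ≤ π Set.univ - π K := tsub_le_tsub_left (measure_mono (Set.subset_preimage_image _ _)) _
    _ ≤ 0 + ε := by
        rw [← hA, zero_add, tsub_le_iff_left]
        exact hKε.le

lemma integrable_exp_of_continuousOn {E : Type*} [TopologicalSpace E] [T2Space E]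
    [MeasurableSpace E] [OpensMeasurableSpace E] [TopologicalSpace.PseudoMetrizableSpace E]
    {X : Set E} (hX : IsCompact X) {p : Measure E} [IsFiniteMeasure p] (hp : p Xᶜ = 0)
    {φ : E → ℝ} (hφ : ContinuousOn φ X) : Integrable (fun x => Real.exp (φ x)) p := by
  have h := (Real.continuous_exp.comp_continuousOn hφ).integrableOn_compact (μ := p) hX
  rwa [IntegrableOn, Measure.restrict_eq_self_of_ae_mem (s := X) hp] at h

end Projection

/-! ### Almost-everywhere gradient statements -/

section Main

variable {E : Type*} [NormedAddCommGroup E] [InnerProductSpace ℝ E] [CompleteSpace E]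
  [SecondCountableTopology E] [MeasurableSpace E] [BorelSpace E]

theorem ae_hasInformativeGradient {X D : Set E} (hX : IsCompact X) (hD : Convex ℝ D) (hXD : X ⊆ D)
    {p q : Measure E} [IsProbabilityMeasure p] [IsProbabilityMeasure q] (hp : p Xᶜ = 0)
    (hq : q Xᶜ = 0) {f : E → ℝ} (hf : IsOptimalCritic D p q f) (hdiff : DifferentiableOn ℝ f D)
    {π : Measure (E × E)} (hπ : IsOptimalCoupling q p π) (hne : π {z | z.1 = z.2} = 0) :
    ∀ᵐ z ∂π, HasInformativeGradient D f z.1 z.2 := by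
  have hne' : ∀ᵐ z ∂π, z.1 ≠ z.2 := by simpa [ae_iff] using hne
  filter_upwards [ae_sub_eq_dist hX hXD hp hq hf hπ, hne'] with z hz hz'
  exact hasInformativeGradient_of_sub_eq_dist hD hf.1 hdiff (hXD hz.1) (hXD hz.2.1) hz.2.2 hz'

theorem ae_exists_hasInformativeGradient {X D : Set E} (hX : IsCompact X) (hD : Convex ℝ D)
    (hXD : X ⊆ D) {p q : Measure E} [IsProbabilityMeasure p] [IsProbabilityMeasure q]
    (hp : p Xᶜ = 0) (hq : q Xᶜ = 0) {f : E → ℝ} (hf : IsOptimalCritic D p q f)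
    (hdiff : DifferentiableOn ℝ f D) {π : Measure (E × E)} (hπ : IsOptimalCoupling q p π)
    (hne : π {z | z.1 = z.2} = 0) :
    ∀ᵐ x ∂q, ∃ y ∈ p.support, y ≠ x ∧ HasInformativeGradient D f x y := by
  have := isProbabilityMeasure_of_mem_couplings hπ.1
  have hne' : ∀ᵐ z ∂π, z.1 ≠ z.2 := by simpa [ae_iff] using hne
  have hsupp := ae_mem_of_mem_couplings hπ.1 (A := Set.univ) (by simp)
    (show ∀ᵐ y ∂p, y ∈ p.support from Measure.support_mem_ae)
  rw [← hπ.1.1]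
  refine ae_exists_of_ae ?_
  filter_upwards [ae_hasInformativeGradient hX hD hXD hp hq hf hdiff hπ hne, hsupp, hne']
    with z hz hz' hz''
  exact ⟨hz'.2, hz''.symm, hz⟩

end Main

end WGan

theorem proposition1 :
    -- on a compact metric space, an optimal discriminator and an optimal coupling exist
    (∀ (X : Type*) [MetricSpace X] [CompactSpace X] [MeasurableSpace X] [BorelSpace X]
        (p_r q : Measure X) [IsProbabilityMeasure p_r] [IsProbabilityMeasure q],
        (∃ f : X → ℝ, WGan.IsOptimalCritic Set.univ p_r q f) ∧
        (∃ π : Measure (X × X), WGan.IsOptimalCoupling q p_r π)) ∧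
    -- the gradient of a differentiable optimal discriminator along an optimal coupling
    (∀ (E : Type*) [NormedAddCommGroup E] [InnerProductSpace ℝ E] [CompleteSpace E]
        [SecondCountableTopology E] [MeasurableSpace E] [BorelSpace E]
        (X D : Set E) (_hX : IsCompact X) (_hD : Convex ℝ D) (_hXD : X ⊆ D)
        (p_r : Measure E) [IsProbabilityMeasure p_r] (_hp_r : p_r Xᶜ = 0),
        (∀ (q : Measure E) [IsProbabilityMeasure q] (_hq : q Xᶜ = 0)
          (f : E → ℝ) (_hf : WGan.IsOptimalCritic D p_r q f) (_hdiff : DifferentiableOn ℝ f D)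
          (π : Measure (E × E)) (_hπ : WGan.IsOptimalCoupling q p_r π)
          (_hne : π {z | z.1 = z.2} = 0),
          ∀ᵐ z ∂π, WGan.HasInformativeGradient D f z.1 z.2) ∧
        -- the exponentially tilted generator distribution
        (∀ (p_θ : Measure E) [IsProbabilityMeasure p_θ] (_hp_θ : p_θ Xᶜ = 0)
          (φ : E → ℝ) (_hφ : ContinuousOn φ X),
          IsProbabilityMeasure (p_θ.tilted φ) ∧
          p_θ.tilted φ ≪ p_θ ∧ p_θ ≪ p_θ.tilted φ ∧
          (p_θ.tilted φ).support = p_θ.support ∧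
          ∀ (f : E → ℝ) (_hf : WGan.IsOptimalCritic D p_r (p_θ.tilted φ) f)
            (_hdiff : DifferentiableOn ℝ f D)
            (π : Measure (E × E)) (_hπ : WGan.IsOptimalCoupling (p_θ.tilted φ) p_r π)
            (_hne : π {z | z.1 = z.2} = 0),
            ∀ᵐ x ∂p_θ, ∃ y ∈ p_r.support, y ≠ x ∧ WGan.HasInformativeGradient D f x y)) := by
  refine ⟨fun X _ _ _ _ p_r q _ _ =>
    ⟨WGan.exists_isOptimalCritic p_r q, WGan.exists_isOptimalCoupling q p_r⟩, ?_⟩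
  intro E _ _ _ _ _ _ X D hX hD hXD p_r _ hp_r
  refine ⟨fun q _ hq f hf hdiff π hπ hne =>
    WGan.ae_hasInformativeGradient hX hD hXD hp_r hq hf hdiff hπ hne, ?_⟩
  intro p_θ _ hp_θ φ hφ
  -- Without integrability the normalising integral would default to zero and the tilt would be the
  -- zero measure.
  have hint := WGan.integrable_exp_of_continuousOn hX hp_θ hφ
  have hprob := isProbabilityMeasure_tilted hint
  have hac := tilted_absolutelyContinuous p_θ φ
  have hac' := absolutelyContinuous_tilted hint
  refine ⟨hprob, hac, hac', hac.support_mono.antisymm hac'.support_mono, ?_⟩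
  intro f hf hdiff π hπ hne
  -- The conclusion holds almost everywhere for the tilt; `p_θ ≪ p_θ.tilted φ` carries it to `p_θ`.
  exact hac'.ae_le
    (WGan.ae_exists_hasInformativeGradient hX hD hXD hp_r (hac hp_θ) hf hdiff hπ hne)
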